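/- **Definitions.** A *proper $H^*$-algebra* is a complex Banach $*$-algebra $\mathcal A$ whose norm is induced by a Hilbert space inner product $\langle\cdot,\cdot\rangle$ (linear in the first argument) with $\langle ab,c\rangle=\langle b,a^*c\rangle=\langle a,cb^*\rangle$ for all $a,b,c\in\mathcal A$, and in which $\mathcal A a=0$ implies $a=0$. An element $a\in\mathcal A$ is *positive* ($a\ge 0$) if $\langle ax,x\rangle\ge 0$ for all $x\in\mathcal A$. The trace class is $\tau(\mathcal A)=\{ab: a,b\in\mathcal A\}$. The square root of a positive $a\in\tau(\mathcal A)$ is the unique positive $a^{1/2}\in\mathcal A$ with $(a^{1/2})^2=a$, and for $a\in\mathcal A$, $|a|$ denotes the square root of $a^*a$. The trace $\mathrm{tr}$ is the linear functional on $\tau(\mathcal A)$ with $\mathrm{tr}(a^*a)=\|a\|^2$, i.e. $\mathrm{tr}(ab)=\langle b,a^*\rangle$ for $a,b\in\mathcal A$, and the trace norm is $\tau(a)=\mathrm{tr}(|a|)$ for $a\in\tau(\mathcal A)$. A *semi-inner product $H^*$-module* over $\mathcal A$ is a right $\mathcal A$-module $X$, which is a complex vector space with $(\lambda x)a=\lambda(xa)=x(\lambda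 a)$ for $\lambda\in\mathbb C$, $x\in X$, $a\in\mathcal A$, together with a map $\langle\cdot,\cdot\rangle:X\times X\to\tau(\mathcal A)$ such that, for all $x,y,z\in X$ and $a\in\mathcal A$, $\langle x,y+z\rangle=\langle x,y\rangle+\langle x,z\rangle$, $\langle x,ya\rangle=\langle x,y\rangle a$, $\langle x,y\rangle^*=\langle y,x\rangle$ and $\langle x,x\rangle\ge 0$. For $x\in X$ put $|x|=\langle x,x\rangle^{1/2}\in\mathcal A$. **Theorem.** Let $X$ be a semi-inner product $H^*$-module over a proper $H^*$-algebra $\mathcal A$, let $a,b\in X$, let $\overline p=(p_1,\dots,p_n)\in\mathbb R^n$ be a probability vector ($p_i\ge 0$, $\sum_{i=1}^n p_i=1$), and let $\overline x=(x_1,\dots,x_n)$, $\overline y=(y_1,\dots,y_n)\in X^n$. Put $$G_{\overline p}(\overline x,\overline y)=\sum_{i=1}^n p_i\langle x_i,y_i\rangle-\Big\langle \sum_{i=1}^n p_ix_i,\ \sum_{i=1}^n p_iy_i\Big\rangle .$$ If $r\ge 0$ and $s\ge 0$ are such that $\big\||x_i-a|\big\|\le r$ and $\big\||y_i-b|\big\|\le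 s$ for all $i\in\{1,\dots,n\}$, then $G_{\overline p}(\overline x,\overline y)\in\tau(\mathcal A)$ and $$\big|\tau(G_{\overline p}(\overline x,\overline y))\big|\le rs-\left\|\Big|\sum_{i=1}^n p_i(x_i-a)\Big|\right\|\left\|\Big|\sum_{i=1}^n p_i(y_i-b)\Big|\right\|\le rs .$$ -/

import Mathlib

open scoped ComplexOrder

/-- A proper `H*`-algebra: a complex Banach `*`-algebra whose norm comes from a Hilbert space inner
product with `⟨ab, c⟩ = ⟨b, a* c⟩ = ⟨a, c b*⟩`, and in which `𝒜 a = 0` forces `a = 0` (properness;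
applying the involution, `a 𝒜 = 0` forces `a = 0` as well). The submultiplicative norm, the inner
product inducing it and the involution are carried by the three instance arguments. -/
class ProperHStarAlgebra (A : Type*) [NonUnitalNormedRing A] [InnerProductSpace ℂ A]
    [StarRing A] : Prop extends
    CompleteSpace A, IsScalarTower ℂ A A, SMulCommClass ℂ A A, StarModule ℂ A where
  inner_mul_eq_left : ∀ a b c : A, inner ℂ (a * b) c = inner ℂ b (star a * c)
  inner_mul_eq_right : ∀ a b c : A, inner ℂ (a * b) c = inner ℂ a (c * star b)
  eq_zero_of_mul_eq_zero : ∀ a : A, (∀ x : A, x * a = 0) → a = 0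

namespace HStar

noncomputable section

section Algebra

variable {A : Type*} [NonUnitalNormedRing A] [InnerProductSpace ℂ A] [StarRing A]

/-- `a ≥ 0`: `⟨a x, x⟩` is real and non-negative for all `x`. -/
def IsPositive (a : A) : Prop := ∀ x : A, 0 ≤ inner ℂ (a * x) x

/-- The trace class `τ(𝒜) = {b c : b, c ∈ 𝒜}`. -/
def traceClass (A : Type*) [NonUnitalNormedRing A] : Set A := {a | ∃ b c : A, a = b * c}

open Classical in
/-- The positive square root of `a`, where there is one (in a proper `H*`-algebra it is unique, and
it exists for `a = b* b` and for positive `a ∈ τ(𝒜)`); `0` otherwise. -/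
def sqrt (a : A) : A :=
  if h : ∃ b : A, IsPositive b ∧ b * b = a then h.choose else 0

/-- `|a|`, the positive square root of `a* a`. -/
def abs (a : A) : A := sqrt (star a * a)

open Classical in
/-- The trace on `τ(𝒜)`. It is the linear functional with `tr (a* a) = ‖a‖²`, that is (by
polarization) `tr (b c) = ⟨c, b*⟩`, linear in `c`; Mathlib's inner product is linear in its second
argument. In a proper `H*`-algebra the value does not depend on the factorization that is chosen.
Outside `τ(𝒜)` the value is `0`. -/
def trace (a : A) : ℂ :=
  if h : ∃ q : A × A, a = q.1 * q.2 then inner ℂ (star h.choose.1) h.choose.2 else 0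

/-- The trace norm `τ(a) = tr |a|` (a non-negative real number). -/
def traceNorm (a : A) : ℝ := (trace (abs a)).re

end Algebra

end

end HStar

/-- A semi-inner product module over a proper `H*`-algebra `A`: a complex vector space `X` with a
right action of `A`, written `MulOpposite.op a • x` for `x a`, which is compatible with complex
scalars, and a `τ(A)`-valued generalized semi-inner product. -/
class SemiInnerHStarModule (A X : Type*) [NonUnitalNormedRing A] [InnerProductSpace ℂ A]
    [StarRing A] [AddCommGroup X] [Module ℂ X] extends SMul Aᵐᵒᵖ X, Inner A X where
  op_smul_add : ∀ (a : A) (x y : X),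
    MulOpposite.op a • (x + y) = MulOpposite.op a • x + MulOpposite.op a • y
  op_add_smul : ∀ (a b : A) (x : X),
    MulOpposite.op (a + b) • x = MulOpposite.op a • x + MulOpposite.op b • x
  op_mul_smul : ∀ (a b : A) (x : X),
    MulOpposite.op (a * b) • x = MulOpposite.op b • (MulOpposite.op a • x)
  op_smul_smul : ∀ (a : A) (z : ℂ) (x : X),
    MulOpposite.op a • (z • x) = z • (MulOpposite.op a • x)
  op_smul_op : ∀ (a : A) (z : ℂ) (x : X),
    MulOpposite.op (z • a) • x = z • (MulOpposite.op a • x)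
  inner_mem : ∀ x y : X, inner x y ∈ HStar.traceClass A
  inner_add_right : ∀ x y z : X, inner x (y + z) = inner x y + inner x z
  inner_op_smul_right : ∀ (x y : X) (a : A), inner x (MulOpposite.op a • y) = inner x y * a
  star_inner : ∀ x y : X, star (inner x y) = inner y x
  inner_self_positive : ∀ x : X, HStar.IsPositive (inner x x)

namespace SemiInnerHStarModule

noncomputable section

variable (A : Type*) {X : Type*} [NonUnitalNormedRing A] [InnerProductSpace ℂ A] [StarRing A]
  [AddCommGroup X] [Module ℂ X] [SemiInnerHStarModule A X]

/-- The absolute value `|x|`, the positive square root of `⟨x, x⟩`. -/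
def absVal (x : X) : A := HStar.sqrt (inner A x x)

/-- `G_p(x, y) = ∑ pᵢ ⟨xᵢ, yᵢ⟩ - ⟨∑ pᵢ xᵢ, ∑ pᵢ yᵢ⟩`. -/
def grussForm {n : ℕ} (p : Fin n → ℝ) (x y : Fin n → X) : A :=
  ∑ i, (p i : ℂ) • (inner A (x i) (y i) : A) -
    inner A (∑ i, (p i : ℂ) • x i) (∑ i, (p i : ℂ) • y i)

end

end SemiInnerHStarModule

/-!
The form `G_p(x, y)` is invariant under translations of the two families, and it equals
`∑ pᵢ ⟨xᵢ - x̄, yᵢ - ȳ⟩`, where `x̄`, `ȳ` are the `p`-means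
(`LinearMap.sum_smul_apply_sub_mean`). The Cauchy–Schwarz inequality
`τ(⟨u, v⟩) ≤ ‖|u|‖ ‖|v|‖` bounds its trace norm by the geometric mean of the two variances. By
Huygens' identity the first variance is at most `r² - ‖|∑ pᵢ (xᵢ - a)|‖²`
(`sum_mul_norm_absVal_sub_mean_sq_le`), and likewise for the second. The claim follows from
`(r² - α²)(s² - β²) ≤ (r s - α β)²`.

The trace norm is handled by duality. `TraceBounded C a` says that `|⟨w, a⟩| ≤ C ‖L_w‖` for all `w`,
where `L_w` is the operator of left multiplication on the Hilbert space `A`. This property is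
visibly stable under sums, and it holds for `⟨u, v⟩` by the scalar Cauchy–Schwarz inequality for
`tr ⟨u, v⟩` (`traceBounded_inner`). Conversely, it implies `a ∈ τ(A)` and `τ(a) ≤ C`: with
`H = L_a* L_a`, functional calculus in the algebra of bounded operators gives regularizations
`f(H)(a* a) ∈ A` of `H^{1/4} = |L_a|^{1/2}` whose norms are at most `√C` by duality, and a weak limit
of these is an element `s` with `L_s = |L_a|^{1/2}` and `‖s‖² ≤ C`
(`TraceBounded.exists_lmul_eq`). So `|a| = s²`, and a second weak limit gives the polar
decomposition `a = u s` (`TraceBounded.exists_eq_mul`). The same construction yields the square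
roots of positive elements of `τ(A)`.

That `tr (b c) = ⟨b*, c⟩` does not depend on the factorization, and that the trace is additive, is
`sum_inner_star_eq_zero`; it rests on the fact that every `c` lies in the closure of `c A`.
-/

namespace HStar

/-! ### The involution is isometric -/

section Involution

variable {A : Type*} [NonUnitalNormedRing A] [InnerProductSpace ℂ A] [StarRing A]
  [ProperHStarAlgebra A]

lemma inner_mul_left (a b c : A) : inner ℂ (a * b) c = inner ℂ b (star a * c) :=
  ProperHStarAlgebra.inner_mul_eq_left a b c

lemma inner_mul_left' (a b c : A) : inner ℂ (a * b) c = inner ℂ a (c * star b) :=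
  ProperHStarAlgebra.inner_mul_eq_right a b c

lemma inner_mul_right (a b c : A) : inner ℂ a (b * c) = inner ℂ (star b * a) c := by
  rw [inner_mul_left, star_star]

lemma eq_zero_of_forall_mul_left {a : A} (h : ∀ x : A, x * a = 0) : a = 0 :=
  ProperHStarAlgebra.eq_zero_of_mul_eq_zero a h

lemma eq_zero_of_forall_mul_right {a : A} (h : ∀ x : A, a * x = 0) : a = 0 := by
  rw [← star_eq_zero]
  refine eq_zero_of_forall_mul_left fun x => ?_
  rw [← star_star x, ← star_mul, h, star_zero]

lemma eq_of_forall_mul_right {a b : A} (h : ∀ x : A, a * x = b * x) : a = b :=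
  sub_eq_zero.1 <| eq_zero_of_forall_mul_right fun x => by rw [sub_mul, h, sub_self]

variable (A) in
/-- Properness says that products span a dense subspace. -/
lemma dense_span_mul : Dense (Submodule.span ℂ {a : A | ∃ x y, a = x * y} : Set A) := by
  rw [Submodule.dense_iff_topologicalClosure_eq_top,
    Submodule.topologicalClosure_eq_top_iff, Submodule.eq_bot_iff]
  intro z hz
  refine eq_zero_of_forall_mul_left fun x => ?_
  rw [← inner_self_eq_zero (𝕜 := ℂ), inner_mul_right]
  exact (Submodule.mem_orthogonal _ _).1 hz _ (Submodule.subset_span ⟨_, _, rfl⟩)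

lemma inner_star_right_of_mem_span {w : A}
    (hw : w ∈ Submodule.span ℂ {a : A | ∃ x y, a = x * y}) (y : A) :
    inner ℂ w (star y) = inner ℂ y (star w) := by
  induction hw using Submodule.span_induction with
  | mem w hw =>
    obtain ⟨a, b, rfl⟩ := hw
    rw [inner_mul_left, ← inner_mul_left', star_mul, ← inner_mul_left]
  | zero => simp
  | add u v _ _ hu hv => rw [inner_add_left, hu, hv, star_add, inner_add_right]
  | smul c u _ hu => rw [inner_smul_left, hu, star_smul, inner_smul_right]; rfl

lemma norm_star_le (x : A) : ‖star x‖ ≤ ‖x‖ := by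
  have key : ∀ w : A, ‖(inner ℂ w (star x) : ℂ)‖ ≤ ‖x‖ * ‖w‖ := by
    refine (dense_span_mul A).induction (fun w hw => ?_) ?_
    · have hnorm : ‖star w‖ = ‖w‖ := by
        have h := inner_star_right_of_mem_span hw (star w)
        rw [star_star, inner_self_eq_norm_sq_to_K, inner_self_eq_norm_sq_to_K] at h
        have h' : ‖w‖ ^ 2 = ‖star w‖ ^ 2 := by exact_mod_cast h
        exact ((sq_eq_sq₀ (norm_nonneg _) (norm_nonneg _)).1 h').symm
      rw [inner_star_right_of_mem_span hw, ← hnorm]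
      exact norm_inner_le_norm _ _
    · exact isClosed_le (by fun_prop) (by fun_prop)
  have h := key (star x)
  rw [inner_self_eq_norm_sq_to_K] at h
  simp only [norm_pow, Complex.coe_algebraMap, Complex.norm_real, norm_norm] at h
  by_contra! hlt
  nlinarith [norm_nonneg x]

lemma norm_star (x : A) : ‖star x‖ = ‖x‖ :=
  (norm_star_le x).antisymm (by simpa using norm_star_le (star x))

end Involution

/-! ### The trace -/

section Trace

variable {A : Type*} [NonUnitalNormedRing A] [InnerProductSpace ℂ A] [StarRing A]
  [ProperHStarAlgebra A]

/-- `∑ bᵢ cᵢ` determines `∑ ⟨bᵢ*, cᵢ⟩`: the functional `(vᵢ) ↦ ∑ ⟨bᵢ*, vᵢ⟩` kills all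
`(cᵢ w)`, and `(cᵢ)` lies in the closure of these vectors. -/
lemma sum_inner_star_eq_zero {ι : Type*} [Fintype ι] (b c : ι → A) (h : ∑ i, b i * c i = 0) :
    ∑ i, (inner ℂ (star (b i)) (c i) : ℂ) = 0 := by
  -- the right ideal generated by the tuple `c`, inside the Hilbert sum of copies of `A`
  let m : A →ₗ[ℂ] PiLp 2 (fun _ : ι => A) :=
    { toFun := fun w => WithLp.toLp 2 fun i => c i * w
      map_add' := fun u v => by ext i; simp [mul_add]
      map_smul' := fun z v => by ext i; simp [mul_smul_comm] }
  have hm (w : A) (i : ι) : m w i = c i * w := rfl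
  let M := (LinearMap.range m).topologicalClosure
  have hbM : WithLp.toLp 2 (fun i => star (b i)) ∈ Mᗮ := by
    rw [Submodule.orthogonal_closure, Submodule.mem_orthogonal']
    rintro _ ⟨w, rfl⟩
    have : ∑ i, (inner ℂ (star (b i)) (c i * w) : ℂ) = inner ℂ (star (∑ i, b i * c i)) w := by
      rw [star_sum, sum_inner]
      exact Finset.sum_congr rfl fun i _ => by rw [inner_mul_right, star_mul]
    rw [PiLp.inner_apply]
    simp only [hm, this, h, star_zero, inner_zero_left]
  have hcM : WithLp.toLp 2 c ∈ M := by
    have hMc : IsClosed (M : Set (PiLp 2 (fun _ : ι => A))) :=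
      Submodule.isClosed_topologicalClosure _
    have : CompleteSpace M := hMc.completeSpace_coe
    obtain ⟨u, hu, v, hv, huv⟩ := M.exists_add_mem_mem_orthogonal (WithLp.toLp 2 c)
    -- the orthogonal part of `c` is annihilated by right multiplications
    have hact (x : A) : Continuous fun t : PiLp 2 (fun _ : ι => A) =>
        (WithLp.toLp 2 fun i => t i * x : PiLp 2 (fun _ : ι => A)) := by
      refine (PiLp.continuous_toLp 2 _).comp ?_
      fun_prop
    have hux (x : A) : (WithLp.toLp 2 fun i => u i * x : PiLp 2 (fun _ : ι => A)) ∈ M := by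
      have hmaps : Set.MapsTo (fun t : PiLp 2 (fun _ : ι => A) =>
          (WithLp.toLp 2 fun i => t i * x : PiLp 2 (fun _ : ι => A)))
          (LinearMap.range m) (LinearMap.range m) := by
        rintro _ ⟨w, rfl⟩
        exact ⟨w * x, by ext i; simp [hm, mul_assoc]⟩
      exact hmaps.closure (hact x) hu
    have hvM (x : A) : (WithLp.toLp 2 fun i => v i * x : PiLp 2 (fun _ : ι => A)) ∈ M := by
      have heq : (WithLp.toLp 2 fun i => v i * x : PiLp 2 (fun _ : ι => A)) =
          m x - WithLp.toLp 2 fun i => u i * x := by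
        ext i
        have hi : c i = u i + v i := congrArg (fun t : PiLp 2 (fun _ : ι => A) => t i) huv
        simp [hm, hi, add_mul]
      rw [heq]
      exact M.sub_mem (Submodule.le_topologicalClosure _ ⟨x, rfl⟩) (hux x)
    have hvO (x : A) : (WithLp.toLp 2 fun i => v i * x : PiLp 2 (fun _ : ι => A)) ∈ Mᗮ := by
      rw [Submodule.orthogonal_closure, Submodule.mem_orthogonal'] at hv ⊢
      rintro _ ⟨w, rfl⟩
      have h0 := hv _ ⟨w * star x, rfl⟩
      rw [PiLp.inner_apply] at h0 ⊢
      rw [← h0]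
      exact Finset.sum_congr rfl fun i _ => by
        simp only [hm]
        rw [inner_mul_left', mul_assoc]
    have hv0 : v = 0 := by
      ext i
      refine eq_zero_of_forall_mul_right fun x => ?_
      have := (Submodule.mem_bot ℂ).1 (M.inf_orthogonal_eq_bot ▸ ⟨hvM x, hvO x⟩ :
        (WithLp.toLp 2 fun i => v i * x : PiLp 2 (fun _ : ι => A)) ∈ (⊥ : Submodule ℂ _))
      exact congrArg (fun t : PiLp 2 (fun _ : ι => A) => t i) this
    rw [huv, hv0, add_zero]
    exact hu
  have := (Submodule.mem_orthogonal' _ _).1 hbM _ hcM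
  rwa [PiLp.inner_apply] at this

lemma trace_mul (b c : A) : trace (b * c) = inner ℂ (star b) c := by
  have hex : ∃ q : A × A, b * c = q.1 * q.2 := ⟨(b, c), rfl⟩
  rw [trace, dif_pos hex]
  have hq := hex.choose_spec
  have := sum_inner_star_eq_zero ![b, -hex.choose.1] ![c, hex.choose.2]
    (by simp [Fin.sum_univ_two, ← hq])
  simp only [Fin.sum_univ_two, Matrix.cons_val, star_neg, inner_neg_left] at this
  linear_combination -this

lemma trace_add {a b : A} (ha : a ∈ traceClass A) (hb : b ∈ traceClass A)
    (hab : a + b ∈ traceClass A) : trace (a + b) = trace a + trace b := by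
  obtain ⟨a₁, a₂, rfl⟩ := ha
  obtain ⟨b₁, b₂, rfl⟩ := hb
  obtain ⟨c₁, c₂, hc⟩ := hab
  have := sum_inner_star_eq_zero ![a₁, b₁, -c₁] ![a₂, b₂, c₂]
    (by simp [Fin.sum_univ_three, hc])
  simp only [Fin.sum_univ_three, Matrix.cons_val, star_neg, inner_neg_left] at this
  rw [hc, trace_mul, trace_mul, trace_mul]
  linear_combination -this

lemma trace_smul {a : A} (ha : a ∈ traceClass A) (z : ℂ) : trace (z • a) = z * trace a := by
  obtain ⟨b, c, rfl⟩ := ha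
  rw [← mul_smul_comm, trace_mul, trace_mul, inner_smul_right]

lemma trace_star {a : A} (ha : a ∈ traceClass A) :
    trace (star a) = starRingEnd ℂ (trace a) := by
  obtain ⟨b, c, rfl⟩ := ha
  rw [star_mul, trace_mul, trace_mul, star_star, inner_conj_symm]

end Trace

end HStar

namespace HStar

open Filter Topology

/-! ### The left regular representation -/

section LeftMultiplication

variable {A : Type*} [NonUnitalNormedRing A] [InnerProductSpace ℂ A] [StarRing A]
  [ProperHStarAlgebra A]

/-- Left multiplication by `a`, as a bounded operator on the Hilbert space `A`. -/
noncomputable def lmul (a : A) : A →L[ℂ] A := ContinuousLinearMap.mul ℂ A a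

@[simp] lemma lmul_apply (a x : A) : lmul a x = a * x := rfl

lemma lmul_mul (a b : A) : lmul (a * b) = lmul a * lmul b := by
  ext x; simp [mul_assoc]

lemma lmul_injective : Function.Injective (lmul : A → A →L[ℂ] A) := fun _ _ h =>
  eq_of_forall_mul_right fun x => congrArg (fun T : A →L[ℂ] A => T x) h

lemma star_lmul (a : A) : star (lmul a) = lmul (star a) := by
  rw [ContinuousLinearMap.star_eq_adjoint, eq_comm, ContinuousLinearMap.eq_adjoint_iff]
  intro x y
  rw [lmul_apply, lmul_apply, inner_mul_left, star_star]

lemma norm_lmul_star (a : A) : ‖lmul (star a)‖ = ‖lmul a‖ := by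
  rw [← star_lmul, ContinuousLinearMap.star_eq_adjoint, LinearIsometryEquiv.norm_map]

/-- Right multiplication is bounded by the operator norm as well, the involution being isometric. -/
lemma norm_mul_le_norm_mul_norm_lmul (a w : A) : ‖a * w‖ ≤ ‖a‖ * ‖lmul w‖ := by
  rw [← norm_star (a * w), star_mul, ← norm_lmul_star w, ← norm_star a, mul_comm ‖_‖]
  exact (lmul (star w)).le_opNorm (star a)

lemma isPositive_iff_lmul_nonneg (a : A) : IsPositive a ↔ 0 ≤ lmul a := by
  rw [ContinuousLinearMap.nonneg_iff_isPositive, ContinuousLinearMap.isPositive_iff_complex]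
  refine forall_congr' fun x => ?_
  rw [lmul_apply, Complex.nonneg_iff, Complex.ext_iff]
  simp only [RCLike.re_to_complex, Complex.ofReal_re, Complex.ofReal_im, true_and]
  exact and_comm

lemma IsPositive.star_eq {a : A} (ha : IsPositive a) : star a = a := by
  apply lmul_injective
  rw [← star_lmul]
  exact (IsSelfAdjoint.of_nonneg ((isPositive_iff_lmul_nonneg a).1 ha)).star_eq

lemma isPositive_star_mul_self (a : A) : IsPositive (star a * a) := fun x => by
  rw [mul_assoc, inner_mul_left, star_star]
  exact (by rw [inner_self_eq_norm_sq_to_K]; positivity : (0 : ℂ) ≤ inner ℂ (a * x) (a * x))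

lemma IsPositive.eq_of_mul_self_eq {b d : A} (hb : IsPositive b) (hd : IsPositive d)
    (h : b * b = d * d) : b = d := by
  apply lmul_injective
  rw [isPositive_iff_lmul_nonneg] at hb hd
  rw [← CFC.sqrt_unique (lmul_mul b b).symm hb, h, CFC.sqrt_unique (lmul_mul d d).symm hd]

lemma sqrt_eq_of_mul_self {a d : A} (hd : IsPositive d) (h : d * d = a) : sqrt a = d := by
  have hex : ∃ b : A, IsPositive b ∧ b * b = a := ⟨d, hd, h⟩
  rw [sqrt, dif_pos hex]
  exact hex.choose_spec.1.eq_of_mul_self_eq hd (hex.choose_spec.2.trans h.symm)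

/-- A bounded net `tᵢ` has a weak cluster point `s`, and `s` acts on the left as the limit of the
`tᵢ` wherever the latter converges. -/
lemma exists_norm_le_forall_tendsto_mul {ι : Type*} {l : Filter ι} [l.NeBot] {t : ι → A} {K : ℝ}
    (hK : ∀ i, ‖t i‖ ≤ K) :
    ∃ s : A, ‖s‖ ≤ K ∧ ∀ y z, Tendsto (fun i => t i * y) l (𝓝 z) → s * y = z := by
  let φ : ι → WeakDual ℂ A := fun i =>
    StrongDual.toWeakDual (InnerProductSpace.toDual ℂ A (t i))
  let F : Ultrafilter ι := Ultrafilter.of l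
  obtain ⟨ψ, hψ, hF⟩ := (WeakDual.isCompact_closedBall (𝕜 := ℂ) (0 : StrongDual ℂ A) K)
    |>.ultrafilter_le_nhds (F.map φ) (by
      rw [le_principal_iff, Ultrafilter.coe_map, Filter.mem_map]
      refine Filter.univ_mem' fun i => ?_
      simp only [Set.mem_preimage, Metric.mem_closedBall, dist_zero_right]
      change ‖InnerProductSpace.toDual ℂ A (t i)‖ ≤ K
      rw [LinearIsometryEquiv.norm_map]
      exact hK i)
  obtain ⟨s, hs⟩ := (InnerProductSpace.toDual ℂ A).surjective (WeakDual.toStrongDual ψ)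
  have hweak (w : A) : Tendsto (fun i => (inner ℂ (t i) w : ℂ)) F (𝓝 (inner ℂ s w)) := by
    have h1 : Tendsto (fun i => φ i w) F (𝓝 (ψ w)) :=
      ((WeakDual.eval_continuous w).tendsto ψ).comp hF
    have h2 : ψ w = inner ℂ s w := by
      rw [← InnerProductSpace.toDual_apply_apply, hs]; rfl
    rw [← h2]
    exact h1
  refine ⟨s, ?_, fun y z hyz => ?_⟩
  · rw [← LinearIsometryEquiv.norm_map (InnerProductSpace.toDual ℂ A) s, hs]
    simpa using hψ
  · refine ext_inner_right ℂ fun w => ?_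
    refine tendsto_nhds_unique (f := fun i => (inner ℂ (t i * y) w : ℂ)) (l := (F : Filter ι))
      ?_ ((hyz.mono_left (Ultrafilter.of_le l)).inner tendsto_const_nhds)
    simp only [inner_mul_left' _ y w]
    exact hweak _

end LeftMultiplication

/-! ### Elements of finite trace norm -/

section TraceBounded

variable {A : Type*} [NonUnitalNormedRing A] [InnerProductSpace ℂ A] [StarRing A]
  [ProperHStarAlgebra A]

/-- `a` has trace norm at most `C`, expressed through the duality between the trace class and
bounded operators: the functional `w ↦ ⟨a, w⟩` is bounded by `C` with respect to the operator norm
of left multiplications. The condition `0 ≤ C` matters only in the zero algebra. -/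
def TraceBounded (C : ℝ) (a : A) : Prop :=
  0 ≤ C ∧ ∀ w : A, ‖(inner ℂ w a : ℂ)‖ ≤ C * ‖lmul w‖

lemma traceBounded_mul (b c : A) : TraceBounded (‖b‖ * ‖c‖) (b * c) := by
  refine ⟨by positivity, fun w => ?_⟩
  rw [inner_mul_right]
  calc ‖(inner ℂ (star b * w) c : ℂ)‖ ≤ ‖star b * w‖ * ‖c‖ := norm_inner_le_norm _ _
    _ ≤ ‖star b‖ * ‖lmul w‖ * ‖c‖ := by gcongr; exact norm_mul_le_norm_mul_norm_lmul _ _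
    _ = ‖b‖ * ‖c‖ * ‖lmul w‖ := by rw [norm_star]; ring

/-- The real functional calculus of `L_{a* a} = L_a* L_a`. -/
noncomputable def gramCalculus (a : A) (f : ℝ → ℝ) : A →L[ℂ] A := cfc f (lmul (star a * a))

lemma lmul_star_mul_self_nonneg (a : A) : 0 ≤ lmul (star a * a) :=
  (isPositive_iff_lmul_nonneg _).1 (isPositive_star_mul_self a)

lemma star_gramCalculus (a : A) (f : ℝ → ℝ) : star (gramCalculus a f) = gramCalculus a f :=
  (cfc_predicate f (lmul (star a * a)) : IsSelfAdjoint _).star_eq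

lemma gramCalculus_mul (a : A) {f g : ℝ → ℝ} (hf : Continuous f) (hg : Continuous g) :
    gramCalculus a f * gramCalculus a g = gramCalculus a (fun x => f x * g x) :=
  (cfc_mul f g _ hf.continuousOn hg.continuousOn).symm

lemma gramCalculus_sub (a : A) {f g : ℝ → ℝ} (hf : Continuous f) (hg : Continuous g) :
    gramCalculus a f - gramCalculus a g = gramCalculus a (fun x => f x - g x) :=
  (cfc_sub f g _ hf.continuousOn hg.continuousOn).symm

lemma gramCalculus_id (a : A) : gramCalculus a (fun x => x) = lmul (star a * a) :=
  cfc_id' ℝ _ (IsSelfAdjoint.of_nonneg (lmul_star_mul_self_nonneg a))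

lemma gramCalculus_one (a : A) : gramCalculus a (fun _ => 1) = 1 :=
  cfc_const_one ℝ _ (IsSelfAdjoint.of_nonneg (lmul_star_mul_self_nonneg a))

lemma gramCalculus_congr (a : A) {f g : ℝ → ℝ} (h : ∀ x, 0 ≤ x → f x = g x) :
    gramCalculus a f = gramCalculus a g :=
  cfc_congr fun _ hx => h _ (spectrum_nonneg_of_nonneg (lmul_star_mul_self_nonneg a) hx)

lemma norm_gramCalculus_le (a : A) {f : ℝ → ℝ} {c : ℝ} (hc : 0 ≤ c)
    (h : ∀ x, 0 ≤ x → |f x| ≤ c) : ‖gramCalculus a f‖ ≤ c :=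
  norm_cfc_le hc fun _ hx => h _ (spectrum_nonneg_of_nonneg (lmul_star_mul_self_nonneg a) hx)

/-- Operators obtained by functional calculus commute with right multiplications. -/
lemma gramCalculus_apply_mul (a : A) (f : ℝ → ℝ) (x y : A) :
    gramCalculus a f (x * y) = gramCalculus a f x * y := by
  have h : Commute (lmul (star a * a)) ((ContinuousLinearMap.mul ℂ A).flip y) := by
    ext x
    simp [mul_assoc]
  exact congrArg (fun T : A →L[ℂ] A => T x) (h.cfc_real f).eq

lemma lmul_gramCalculus (a : A) (f : ℝ → ℝ) (x : A) :
    lmul (gramCalculus a f x) = gramCalculus a f * lmul x := by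
  ext y
  simp [gramCalculus_apply_mul]

lemma inner_gramCalculus (a : A) (f : ℝ → ℝ) (x y : A) :
    (inner ℂ (gramCalculus a f x) y : ℂ) = inner ℂ x (gramCalculus a f y) := by
  conv_lhs => rw [← star_gramCalculus, ContinuousLinearMap.star_eq_adjoint,
    ContinuousLinearMap.adjoint_inner_left]

/-- Since `(L_a f(L_a* L_a))* (L_a f(L_a* L_a)) = (x f(x)²)(L_a* L_a)`, the norm of
`L_a f(L_a* L_a)` is controlled by `f(x)² x`. -/
lemma norm_lmul_mul_gramCalculus_le (a : A) {f : ℝ → ℝ} (hf : Continuous f) {c : ℝ} (hc : 0 ≤ c)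
    (h : ∀ x, 0 ≤ x → f x ^ 2 * x ≤ c ^ 2) : ‖lmul a * gramCalculus a f‖ ≤ c := by
  have h1 : star (lmul a * gramCalculus a f) * (lmul a * gramCalculus a f) =
      gramCalculus a (fun x => f x * x * f x) := by
    rw [← gramCalculus_mul a (by fun_prop) hf, ← gramCalculus_mul a hf (by fun_prop),
      gramCalculus_id, lmul_mul, ← star_lmul, star_mul, star_gramCalculus]
    simp only [mul_assoc]
  have h2 : ‖lmul a * gramCalculus a f‖ * ‖lmul a * gramCalculus a f‖ ≤ c ^ 2 := by
    rw [← CStarRing.norm_star_mul_self, h1]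
    refine norm_gramCalculus_le a (sq_nonneg c) fun x hx => ?_
    have : f x * x * f x = f x ^ 2 * x := by ring
    rw [this, abs_of_nonneg (by positivity)]
    exact h x hx
  nlinarith [norm_nonneg (lmul a * gramCalculus a f)]

/-- The fourth root on `[0, ∞)`; it vanishes on negative reals. -/
noncomputable def fourthRoot (x : ℝ) : ℝ := √√x

lemma continuous_fourthRoot : Continuous fourthRoot :=
  Real.continuous_sqrt.comp Real.continuous_sqrt

lemma fourthRoot_nonneg (x : ℝ) : 0 ≤ fourthRoot x := Real.sqrt_nonneg _

lemma fourthRoot_pow {x : ℝ} (hx : 0 ≤ x) : fourthRoot x ^ 4 = x := by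
  have : fourthRoot x ^ 4 = ((√√x) ^ 2) ^ 2 := by rw [fourthRoot]; ring
  rw [this, Real.sq_sqrt (Real.sqrt_nonneg _), Real.sq_sqrt hx]

lemma regularized_pos (x : ℝ) {ε : ℝ} (hε : 0 < ε) : 0 < fourthRoot x ^ 4 + ε ^ 4 := by
  positivity

lemma continuous_regularized (k : ℕ) {ε : ℝ} (hε : 0 < ε) :
    Continuous fun x => fourthRoot x ^ k / (fourthRoot x ^ 4 + ε ^ 4) :=
  (continuous_fourthRoot.pow k).div ((continuous_fourthRoot.pow 4).add continuous_const)
    fun x => (regularized_pos x hε).ne'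

/-- An element of trace norm at most `C` has an element `s` of norm at most `√C` with
`L_s = (L_a* L_a)^{1/4}`. It is a weak limit of the elements `f(L_a* L_a) (a* a)`, where
`f(q⁴) = q / (q⁴ + ε⁴)`. -/
lemma TraceBounded.exists_lmul_eq {C : ℝ} {a : A} (ha : TraceBounded C a) :
    ∃ s : A, ‖s‖ ^ 2 ≤ C ∧ lmul s = gramCalculus a fourthRoot := by
  let ε : ℕ → ℝ := fun n => 1 / ((n : ℝ) + 1)
  have hε (n : ℕ) : 0 < ε n := by positivity
  let g : ℕ → ℝ → ℝ := fun n x => fourthRoot x ^ 1 / (fourthRoot x ^ 4 + ε n ^ 4)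
  have hg (n : ℕ) : Continuous (g n) := continuous_regularized 1 (hε n)
  have hgx (n : ℕ) : Continuous fun x => g n x * x := (hg n).mul continuous_id'
  have hgg (n : ℕ) : Continuous fun x => g n x * g n x := (hg n).mul (hg n)
  have hggx (n : ℕ) : Continuous fun x => g n x * g n x * x := (hgg n).mul continuous_id'
  let t : ℕ → A := fun n => gramCalculus a (g n) (star a * a)
  -- `‖t n‖² = ⟨a f(H)² (a* a), a⟩` with `H = L_{a* a}`, which duality bounds by `C ‖L_a f(H)² H‖`
  have hsq (n : ℕ) : ‖t n‖ ^ 2 ≤ C := by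
    let T := lmul a * gramCalculus a (fun x => g n x * g n x * x)
    have h1 : (inner ℂ (t n) (t n) : ℂ) =
        inner ℂ (a * gramCalculus a (g n) (t n)) a := by
      rw [inner_mul_left, ← inner_gramCalculus]
    have h2 : lmul (a * gramCalculus a (g n) (t n)) = T := by
      rw [lmul_mul, lmul_gramCalculus, lmul_gramCalculus, ← mul_assoc (gramCalculus a (g n)),
        gramCalculus_mul a (hg n) (hg n), ← gramCalculus_id,
        gramCalculus_mul a (hgg n) continuous_id']
    have h3 : ‖T‖ ≤ 1 := by
      refine norm_lmul_mul_gramCalculus_le a (hggx n) zero_le_one fun x hx => ?_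
      have hd := regularized_pos x (hε n)
      have hq := fourthRoot_nonneg x
      have hx4 := fourthRoot_pow hx
      have : (g n x * g n x * x) ^ 2 * x =
          (fourthRoot x ^ 4 / (fourthRoot x ^ 4 + ε n ^ 4)) ^ 4 := by
        simp only [g]
        generalize fourthRoot x = q at *
        subst hx4
        field_simp
      rw [this, one_pow]
      refine pow_le_one₀ (by positivity) ((div_le_one hd).2 ?_)
      have := hε n
      linarith [pow_pos this 4]
    have h4 := ha.2 (a * gramCalculus a (g n) (t n))
    rw [h2, ← h1, inner_self_eq_norm_sq_to_K] at h4
    simp only [norm_pow, Complex.coe_algebraMap, Complex.norm_real, norm_norm] at h4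
    exact h4.trans (mul_le_of_le_one_right ha.1 h3)
  obtain ⟨s, hs, hlim⟩ := exists_norm_le_forall_tendsto_mul (l := atTop) (K := √C)
    (fun n => Real.le_sqrt_of_sq_le (hsq n))
  refine ⟨s, ?_, ?_⟩
  · calc ‖s‖ ^ 2 ≤ √C ^ 2 := by gcongr
      _ = C := Real.sq_sqrt ha.1
  · have hconv : Tendsto (fun n => lmul (t n)) atTop (𝓝 (gramCalculus a fourthRoot)) := by
      rw [tendsto_iff_norm_sub_tendsto_zero]
      refine squeeze_zero (fun _ => norm_nonneg _) (fun n => ?_)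
        (tendsto_one_div_add_atTop_nhds_zero_nat (𝕜 := ℝ))
      rw [lmul_gramCalculus, ← gramCalculus_id, gramCalculus_mul a (hg n) continuous_id',
        gramCalculus_sub a (hgx n) continuous_fourthRoot]
      refine norm_gramCalculus_le a (hε n).le fun x hx => ?_
      have he := hε n
      have hd := regularized_pos x he
      have hq := fourthRoot_nonneg x
      have hx4 := fourthRoot_pow hx
      have : g n x * x - fourthRoot x =
          -(ε n ^ 4 * fourthRoot x / (fourthRoot x ^ 4 + ε n ^ 4)) := by
        simp only [g]
        generalize fourthRoot x = q at *
        subst hx4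
        field_simp
        ring
      rw [this, abs_neg, abs_of_nonneg (by positivity), div_le_iff₀ hd]
      generalize fourthRoot x = q at *
      change ε n ^ 4 * q ≤ ε n * (q ^ 4 + ε n ^ 4)
      generalize ε n = e at *
      have : e ^ 3 * q ≤ q ^ 4 + e ^ 4 := by
        nlinarith [sq_nonneg (q * e - e ^ 2), sq_nonneg (q ^ 2 - e ^ 2), sq_nonneg (q * e)]
      nlinarith
    ext y
    exact hlim y _ (((ContinuousLinearMap.apply ℂ A y).continuous.tendsto _).comp hconv)

/-- Polar decomposition of an element of finite trace norm: `a = u s` with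
`s = |a|^{1/2}`. The factor `u` is a weak limit of the elements `a f(L_a* L_a) s`, where
`f(q⁴) = q² / (q⁴ + ε⁴)`. -/
lemma TraceBounded.exists_eq_mul {C : ℝ} {a : A} (ha : TraceBounded C a) :
    ∃ u s : A, a = u * s ∧ IsPositive s ∧ (s * s) * (s * s) = star a * a ∧ ‖s‖ ^ 2 ≤ C := by
  obtain ⟨s, hsC, hs⟩ := ha.exists_lmul_eq
  have hc := continuous_fourthRoot
  have hcc : Continuous fun x => fourthRoot x * fourthRoot x := hc.mul hc
  let ε : ℕ → ℝ := fun n => 1 / ((n : ℝ) + 1)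
  have hε (n : ℕ) : 0 < ε n := by positivity
  let k : ℕ → ℝ → ℝ := fun n x => fourthRoot x ^ 2 / (fourthRoot x ^ 4 + ε n ^ 4)
  have hk (n : ℕ) : Continuous (k n) := continuous_regularized 2 (hε n)
  have hkc (n : ℕ) : Continuous fun x => k n x * (fourthRoot x * fourthRoot x) := (hk n).mul hcc
  have hkc1 (n : ℕ) : Continuous fun x => k n x * (fourthRoot x * fourthRoot x) - 1 :=
    (hkc n).sub continuous_const
  have hkx (n : ℕ) (x : ℝ) (hx : 0 ≤ x) : k n x ^ 2 * x ≤ 1 ^ 2 := by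
    have hd := regularized_pos x (hε n)
    have hq := fourthRoot_nonneg x
    have hx4 := fourthRoot_pow hx
    have : k n x ^ 2 * x = (fourthRoot x ^ 4 / (fourthRoot x ^ 4 + ε n ^ 4)) ^ 2 := by
      simp only [k]
      generalize fourthRoot x = q at *
      subst hx4
      field_simp
    rw [this]
    gcongr
    refine (div_le_one hd).2 ?_
    have := hε n
    linarith [pow_pos this 4]
  let v : ℕ → A := fun n => a * gramCalculus a (k n) s
  have hv (n : ℕ) : ‖v n‖ ≤ ‖s‖ :=
    calc ‖v n‖ = ‖(lmul a * gramCalculus a (k n)) s‖ := rfl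
      _ ≤ ‖lmul a * gramCalculus a (k n)‖ * ‖s‖ := ContinuousLinearMap.le_opNorm _ _
      _ ≤ 1 * ‖s‖ := by
        gcongr
        exact norm_lmul_mul_gramCalculus_le a (hk n) zero_le_one (hkx n)
      _ = ‖s‖ := one_mul _
  obtain ⟨u, -, hu⟩ := exists_norm_le_forall_tendsto_mul (l := atTop) hv
  have hconv : Tendsto (fun n => lmul (v n * s)) atTop (𝓝 (lmul a)) := by
    rw [tendsto_iff_norm_sub_tendsto_zero]
    have h0 : Tendsto (fun n => ε n ^ 2) atTop (𝓝 0) := by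
      rw [← zero_pow two_ne_zero]
      exact (tendsto_one_div_add_atTop_nhds_zero_nat (𝕜 := ℝ)).pow 2
    refine squeeze_zero (fun _ => norm_nonneg _) (fun n => ?_) h0
    have h1 : lmul (v n * s) - lmul a =
        lmul a * gramCalculus a (fun x => k n x * (fourthRoot x * fourthRoot x) - 1) := by
      rw [← gramCalculus_sub a (hkc n) continuous_const, gramCalculus_one,
        ← gramCalculus_mul a (hk n) hcc, ← gramCalculus_mul a hc hc, lmul_mul, lmul_mul,
        lmul_gramCalculus, hs, mul_sub, mul_one]
      simp only [mul_assoc]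
    rw [h1]
    refine norm_lmul_mul_gramCalculus_le a (hkc1 n) (by positivity) fun x hx => ?_
    have he := hε n
    have hd := regularized_pos x he
    have hq := fourthRoot_nonneg x
    have hx4 := fourthRoot_pow hx
    have : (k n x * (fourthRoot x * fourthRoot x) - 1) ^ 2 * x =
        (ε n ^ 4 * fourthRoot x ^ 2 / (fourthRoot x ^ 4 + ε n ^ 4)) ^ 2 := by
      simp only [k]
      generalize fourthRoot x = q at *
      subst hx4
      field_simp
      ring
    rw [this]
    gcongr
    rw [div_le_iff₀ hd]
    generalize fourthRoot x = q at *
    generalize ε n = e at *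
    have : e ^ 2 * q ^ 2 ≤ q ^ 4 + e ^ 4 := by
      nlinarith [sq_nonneg (q ^ 2 - e ^ 2), sq_nonneg (q * e)]
    nlinarith [sq_nonneg e]
  refine ⟨u, s, ?_, ?_, ?_, hsC⟩
  · refine eq_of_forall_mul_right fun y => ?_
    rw [mul_assoc, eq_comm]
    refine hu _ _ ?_
    simp only [← mul_assoc]
    exact ((ContinuousLinearMap.apply ℂ A y).continuous.tendsto _).comp hconv
  · rw [isPositive_iff_lmul_nonneg, hs]
    exact cfc_nonneg fun x _ => fourthRoot_nonneg x
  · apply lmul_injective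
    rw [lmul_mul, lmul_mul, hs, gramCalculus_mul a hc hc,
      gramCalculus_mul a hcc hcc, ← gramCalculus_id]
    refine gramCalculus_congr a fun x hx => ?_
    conv_rhs => rw [← fourthRoot_pow hx]
    ring

lemma TraceBounded.mem_traceClass {C : ℝ} {a : A} (ha : TraceBounded C a) :
    a ∈ traceClass A := by
  obtain ⟨u, s, h, -⟩ := ha.exists_eq_mul
  exact ⟨u, s, h⟩

/-- The dual bound dominates the trace norm, which equals `‖s‖²` for the `s = |a|^{1/2}` above. -/
lemma TraceBounded.traceNorm_mem_Icc {C : ℝ} {a : A} (ha : TraceBounded C a) :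
    traceNorm a ∈ Set.Icc 0 C := by
  obtain ⟨-, s, -, hs, h, hC⟩ := ha.exists_eq_mul
  have hpos : IsPositive (s * s) := by
    simpa only [hs.star_eq] using isPositive_star_mul_self s
  have : traceNorm a = ‖s‖ ^ 2 := by
    rw [traceNorm, abs, sqrt_eq_of_mul_self hpos h, trace_mul, hs.star_eq, inner_self_eq_norm_sq_to_K]
    norm_cast
  rw [this]
  exact ⟨sq_nonneg _, hC⟩

/-- A positive element of the trace class has a positive square root. -/
lemma IsPositive.sqrt_spec {a : A} (ha : IsPositive a) (hmem : a ∈ traceClass A) :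
    IsPositive (sqrt a) ∧ sqrt a * sqrt a = a := by
  obtain ⟨b, c, hbc⟩ := hmem
  obtain ⟨-, s, -, hs, h, -⟩ := (hbc ▸ traceBounded_mul b c : TraceBounded _ a).exists_eq_mul
  have hpos : IsPositive (s * s) := by
    simpa only [hs.star_eq] using isPositive_star_mul_self s
  have hsa : s * s = a := hpos.eq_of_mul_self_eq ha (by rw [h, ha.star_eq])
  rw [sqrt_eq_of_mul_self hs hsa]
  exact ⟨hs, hsa⟩

end TraceBounded

end HStar

/-! ### Sums and scalar multiples of elements of finite trace norm -/

namespace HStar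

section TraceBounded

variable {A : Type*} [NonUnitalNormedRing A] [InnerProductSpace ℂ A] [StarRing A]
  [ProperHStarAlgebra A]

lemma traceBounded_zero : TraceBounded 0 (0 : A) := ⟨le_rfl, fun w => by simp⟩

lemma TraceBounded.add {C D : ℝ} {a b : A} (ha : TraceBounded C a) (hb : TraceBounded D b) :
    TraceBounded (C + D) (a + b) := by
  refine ⟨add_nonneg ha.1 hb.1, fun w => ?_⟩
  rw [inner_add_right, add_mul]
  exact (norm_add_le _ _).trans (add_le_add (ha.2 w) (hb.2 w))

lemma TraceBounded.smul {C : ℝ} {a : A} (ha : TraceBounded C a) {t : ℝ} (ht : 0 ≤ t) :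
    TraceBounded (t * C) ((t : ℂ) • a) := by
  refine ⟨mul_nonneg ht ha.1, fun w => ?_⟩
  rw [inner_smul_right, norm_mul, Complex.norm_real, Real.norm_of_nonneg ht, mul_assoc]
  exact mul_le_mul_of_nonneg_left (ha.2 w) ht

lemma traceBounded_sum {ι : Type*} (S : Finset ι) {C : ι → ℝ} {a : ι → A}
    (h : ∀ i, TraceBounded (C i) (a i)) : TraceBounded (∑ i ∈ S, C i) (∑ i ∈ S, a i) := by
  classical
  induction S using Finset.induction_on with
  | empty => simpa using traceBounded_zero
  | insert i S hi ih =>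
    rw [Finset.sum_insert hi, Finset.sum_insert hi]
    exact (h i).add ih

end TraceBounded

end HStar

/-! ### Cauchy–Schwarz inequalities in a semi-inner product module -/

namespace SemiInnerHStarModule

open HStar

section Elementary

variable (A : Type*) {X : Type*} [NonUnitalNormedRing A] [InnerProductSpace ℂ A] [StarRing A]
  [AddCommGroup X] [Module ℂ X] [SemiInnerHStarModule A X]

lemma inner_add_left (x y z : X) : inner A (x + y) z = inner A x z + inner A y z := by
  rw [← star_inner, inner_add_right, star_add, star_inner, star_inner]

lemma inner_op_smul_left (x y : X) (a : A) :
    inner A (MulOpposite.op a • x) y = star a * inner A x y := by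
  rw [← star_inner, inner_op_smul_right, star_mul, star_inner]

end Elementary

section CauchySchwarz

variable (A : Type*) {X : Type*} [NonUnitalNormedRing A] [InnerProductSpace ℂ A] [StarRing A]
  [ProperHStarAlgebra A] [AddCommGroup X] [Module ℂ X] [SemiInnerHStarModule A X]

/-- Complex homogeneity is not an axiom; it follows from compatibility of the two actions, since an
element of `A` is determined by its products with all elements. -/
lemma inner_smul_right (z : ℂ) (x y : X) : inner A x (z • y) = z • inner A x y := by
  refine eq_of_forall_mul_right fun a => ?_
  rw [← inner_op_smul_right, op_smul_smul, ← op_smul_op, inner_op_smul_right, mul_smul_comm,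
    smul_mul_assoc]

lemma inner_smul_left (z : ℂ) (x y : X) :
    inner A (z • x) y = starRingEnd ℂ z • inner A x y := by
  rw [← star_inner, inner_smul_right, star_smul, star_inner]
  rfl

variable (X) in
/-- The `A`-valued semi-inner product as a sesquilinear map. -/
noncomputable def innerForm : X →ₗ⋆[ℂ] X →ₗ[ℂ] A :=
  LinearMap.mk₂'ₛₗ (starRingEnd ℂ) (RingHom.id ℂ) (fun x y => inner A x y) (inner_add_left A)
    (inner_smul_left A) inner_add_right (inner_smul_right A)

variable (X) in
/-- The scalar semi-inner product `tr ⟨x, y⟩` as a sesquilinear form. -/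
noncomputable def traceForm : X →ₗ⋆[ℂ] X →ₗ[ℂ] ℂ :=
  LinearMap.mk₂'ₛₗ (starRingEnd ℂ) (RingHom.id ℂ) (fun x y => trace (inner A x y))
    (fun x y z => by
      rw [inner_add_left]
      exact trace_add (inner_mem _ _) (inner_mem _ _) (inner_add_left A x y z ▸ inner_mem _ _))
    (fun c x y => by
      rw [inner_smul_left]
      exact trace_smul (inner_mem _ _) _)
    (fun x y z => by
      rw [inner_add_right]
      exact trace_add (inner_mem _ _) (inner_mem _ _)
        ((inner_add_right (A := A) x y z) ▸ inner_mem _ _))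
    (fun c x y => by
      rw [inner_smul_right]
      exact trace_smul (inner_mem _ _) _)

lemma traceForm_apply (x y : X) : traceForm A X x y = trace (inner A x y) := rfl

lemma star_absVal (x : X) : star (absVal A x) = absVal A x :=
  ((inner_self_positive x).sqrt_spec (inner_mem x x)).1.star_eq

lemma absVal_mul_absVal (x : X) : absVal A x * absVal A x = inner A x x :=
  ((inner_self_positive x).sqrt_spec (inner_mem x x)).2

lemma trace_inner_self (x : X) : trace (inner A x x) = ((‖absVal A x‖ ^ 2 : ℝ) : ℂ) := by
  rw [← absVal_mul_absVal, trace_mul, star_absVal, inner_self_eq_norm_sq_to_K]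
  norm_cast

/-- Cauchy–Schwarz for the scalar semi-inner product `tr ⟨x, y⟩`. -/
lemma norm_trace_inner_le (x y : X) :
    ‖trace (inner A x y)‖ ≤ ‖absVal A x‖ * ‖absVal A y‖ := by
  let core : PreInnerProductSpace.Core ℂ X :=
    { inner := fun x y => traceForm A X x y
      conj_inner_symm := fun x y => by
        rw [traceForm_apply, traceForm_apply, ← trace_star (inner_mem y x), star_inner]
      re_inner_nonneg := fun x => by
        rw [traceForm_apply, trace_inner_self, RCLike.re_to_complex, Complex.ofReal_re]
        positivity
      add_left := fun x y z => by rw [map_add, LinearMap.add_apply]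
      smul_left := fun x y r => by
        rw [LinearMap.map_smulₛₗ, LinearMap.smul_apply, smul_eq_mul] }
  have h := @InnerProductSpace.Core.inner_mul_inner_self_le ℂ X _ _ _ core x y
  have hi (x y : X) : core.toInner.inner x y = trace (inner A x y) := rfl
  rw [hi, hi, hi, hi, trace_inner_self, trace_inner_self, RCLike.re_to_complex,
    RCLike.re_to_complex, Complex.ofReal_re, Complex.ofReal_re, ← star_inner x y,
    trace_star (inner_mem _ _), RCLike.norm_conj] at h
  refine le_of_sq_le_sq ?_ (by positivity)
  rw [mul_pow, sq]
  exact h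

lemma norm_absVal_op_smul (x : X) (w : A) :
    ‖absVal A (MulOpposite.op w • x)‖ = ‖absVal A x * w‖ := by
  have h := trace_inner_self A (MulOpposite.op w • x)
  have h1 : (inner A (MulOpposite.op w • x) (MulOpposite.op w • x) : A) =
      star (absVal A x * w) * (absVal A x * w) := by
    rw [inner_op_smul_right, inner_op_smul_left, ← absVal_mul_absVal, star_mul, star_absVal]
    simp only [mul_assoc]
  rw [h1, trace_mul, star_star, inner_self_eq_norm_sq_to_K] at h
  rw [← RCLike.ofReal_pow] at h
  have h' : ‖absVal A x * w‖ ^ 2 = ‖absVal A (MulOpposite.op w • x)‖ ^ 2 :=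
    Complex.ofReal_injective h
  exact ((sq_eq_sq₀ (norm_nonneg _) (norm_nonneg _)).1 h').symm

/-- Cauchy–Schwarz in the trace norm. It reduces to the scalar inequality for `x w` and `y`, because
`⟨w, ⟨x, y⟩⟩ = tr (w* ⟨x, y⟩) = tr ⟨x w, y⟩`. -/
lemma traceBounded_inner (x y : X) :
    TraceBounded (‖absVal A x‖ * ‖absVal A y‖) (inner A x y) := by
  refine ⟨by positivity, fun w => ?_⟩
  have h : (inner ℂ w (inner A x y) : ℂ) = trace (inner A (MulOpposite.op w • x) y) := by
    rw [inner_op_smul_left, trace_mul, star_star]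
  rw [h]
  calc ‖trace (inner A (MulOpposite.op w • x) y)‖
      ≤ ‖absVal A (MulOpposite.op w • x)‖ * ‖absVal A y‖ := norm_trace_inner_le A _ _
    _ ≤ ‖absVal A x‖ * ‖lmul w‖ * ‖absVal A y‖ := by
      rw [norm_absVal_op_smul]
      gcongr
      exact norm_mul_le_norm_mul_norm_lmul _ _
    _ = ‖absVal A x‖ * ‖absVal A y‖ * ‖lmul w‖ := by ring

end CauchySchwarz

end SemiInnerHStarModule

/-! ### Centring at the mean -/

section Centering

/-- The covariance of two families equals the mean of the form on the centred families. -/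
lemma LinearMap.sum_smul_apply_sub_mean {X M ι : Type*} [Fintype ι] [AddCommGroup X] [Module ℂ X]
    [AddCommGroup M] [Module ℂ M] (B : X →ₗ⋆[ℂ] X →ₗ[ℂ] M) (p : ι → ℝ) (hp : ∑ i, p i = 1)
    (x y : ι → X) :
    ∑ i, (p i : ℂ) • B (x i - ∑ j, (p j : ℂ) • x j) (y i - ∑ j, (p j : ℂ) • y j) =
      ∑ i, (p i : ℂ) • B (x i) (y i) - B (∑ i, (p i : ℂ) • x i) (∑ i, (p i : ℂ) • y i) := by
  have hp' : ∑ i, (p i : ℂ) = 1 := by exact_mod_cast congrArg (fun t : ℝ => (t : ℂ)) hp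
  have h1 (v : X) : ∑ i, (p i : ℂ) • B (x i) v = B (∑ i, (p i : ℂ) • x i) v := by
    rw [map_sum, LinearMap.sum_apply]
    refine Finset.sum_congr rfl fun i _ => ?_
    rw [LinearMap.map_smulₛₗ, LinearMap.smul_apply, Complex.conj_ofReal]
  have h2 (u : X) : ∑ i, (p i : ℂ) • B u (y i) = B u (∑ i, (p i : ℂ) • y i) := by
    simp only [map_sum, map_smul]
  simp only [map_sub, LinearMap.sub_apply, smul_sub, Finset.sum_sub_distrib, h1, h2,
    ← Finset.sum_smul, hp', one_smul]
  abel

lemma sub_mean_sub {X ι : Type*} [Fintype ι] [AddCommGroup X] [Module ℂ X] (p : ι → ℝ)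
    (hp : ∑ i, p i = 1) (x : ι → X) (a : X) (i : ι) :
    (x i - a) - ∑ j, (p j : ℂ) • (x j - a) = x i - ∑ j, (p j : ℂ) • x j := by
  have hp' : ∑ i, (p i : ℂ) = 1 := by exact_mod_cast congrArg (fun t : ℝ => (t : ℂ)) hp
  simp only [smul_sub, Finset.sum_sub_distrib, ← Finset.sum_smul, hp', one_smul]
  abel

end Centering

namespace SemiInnerHStarModule

open HStar

variable (A : Type*) {X : Type*} [NonUnitalNormedRing A] [InnerProductSpace ℂ A] [StarRing A]
  [ProperHStarAlgebra A] [AddCommGroup X] [Module ℂ X] [SemiInnerHStarModule A X]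

/-- Huygens' identity: the variance is the second moment about `a` minus the squared distance from
`a` to the mean. -/
lemma sum_mul_norm_absVal_sub_mean_sq {n : ℕ} (p : Fin n → ℝ) (hp : ∑ i, p i = 1) (x : Fin n → X)
    (a : X) :
    ∑ i, p i * ‖absVal A (x i - ∑ j, (p j : ℂ) • x j)‖ ^ 2 =
      ∑ i, p i * ‖absVal A (x i - a)‖ ^ 2 - ‖absVal A (∑ i, (p i : ℂ) • (x i - a))‖ ^ 2 := by
  have h := (traceForm A X).sum_smul_apply_sub_mean p hp (fun i => x i - a) (fun i => x i - a)
  simp only [sub_mean_sub p hp, traceForm_apply, trace_inner_self, smul_eq_mul] at h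
  exact_mod_cast h

/-- The variance of a family lying in the ball of radius `r` about `a`. -/
lemma sum_mul_norm_absVal_sub_mean_sq_le {n : ℕ} (p : Fin n → ℝ) (hp_nonneg : ∀ i, 0 ≤ p i)
    (hp : ∑ i, p i = 1) (x : Fin n → X) (a : X) {r : ℝ} (hx : ∀ i, ‖absVal A (x i - a)‖ ≤ r) :
    ∑ i, p i * ‖absVal A (x i - ∑ j, (p j : ℂ) • x j)‖ ^ 2 ≤
      r ^ 2 - ‖absVal A (∑ i, (p i : ℂ) • (x i - a))‖ ^ 2 := by
  rw [sum_mul_norm_absVal_sub_mean_sq A p hp x a]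
  gcongr
  calc ∑ i, p i * ‖absVal A (x i - a)‖ ^ 2 ≤ ∑ i, p i * r ^ 2 :=
        Finset.sum_le_sum fun i _ => mul_le_mul_of_nonneg_left
          (pow_le_pow_left₀ (norm_nonneg _) (hx i) 2) (hp_nonneg i)
    _ = r ^ 2 := by rw [← Finset.sum_mul, hp, one_mul]

/-- The Grüss form is the `p`-mean of the inner products of the centred families. -/
lemma traceBounded_grussForm {n : ℕ} (p : Fin n → ℝ) (hp_nonneg : ∀ i, 0 ≤ p i)
    (hp : ∑ i, p i = 1) (x y : Fin n → X) :
    TraceBounded (∑ i, p i * (‖absVal A (x i - ∑ j, (p j : ℂ) • x j)‖ *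
      ‖absVal A (y i - ∑ j, (p j : ℂ) • y j)‖)) (grussForm A p x y) := by
  have h : grussForm A p x y = ∑ i, (p i : ℂ) •
      (inner A (x i - ∑ j, (p j : ℂ) • x j) (y i - ∑ j, (p j : ℂ) • y j) : A) :=
    ((innerForm A X).sum_smul_apply_sub_mean p hp x y).symm
  rw [h]
  exact traceBounded_sum _ fun i => (traceBounded_inner A _ _).smul (hp_nonneg i)

end SemiInnerHStarModule

/-! ### The Grüss inequality -/

open SemiInnerHStarModule in
theorem theorem5p2 {A X : Type*} [NonUnitalNormedRing A] [InnerProductSpace ℂ A] [StarRing A]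
    [ProperHStarAlgebra A] [AddCommGroup X] [Module ℂ X] [SemiInnerHStarModule A X]
    {n : ℕ} (p : Fin n → ℝ) (hp_nonneg : ∀ i, 0 ≤ p i) (hp_sum : ∑ i, p i = 1)
    (a b : X) (x y : Fin n → X) (r s : ℝ) (hr : 0 ≤ r) (hs : 0 ≤ s)
    (hx : ∀ i, ‖SemiInnerHStarModule.absVal A (x i - a)‖ ≤ r)
    (hy : ∀ i, ‖SemiInnerHStarModule.absVal A (y i - b)‖ ≤ s) :
    SemiInnerHStarModule.grussForm A p x y ∈ HStar.traceClass A ∧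
    |HStar.traceNorm (SemiInnerHStarModule.grussForm A p x y)| ≤
      r * s - ‖SemiInnerHStarModule.absVal A (∑ i, (p i : ℂ) • (x i - a))‖ *
        ‖SemiInnerHStarModule.absVal A (∑ i, (p i : ℂ) • (y i - b))‖ ∧
    r * s - ‖SemiInnerHStarModule.absVal A (∑ i, (p i : ℂ) • (x i - a))‖ *
        ‖SemiInnerHStarModule.absVal A (∑ i, (p i : ℂ) • (y i - b))‖ ≤ r * s := by
  have hG := traceBounded_grussForm A p hp_nonneg hp_sum x y
  refine ⟨hG.mem_traceClass, ?_, sub_le_self _ (by positivity)⟩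
  rw [abs_of_nonneg hG.traceNorm_mem_Icc.1]
  refine hG.traceNorm_mem_Icc.2.trans ?_
  have hVx := sum_mul_norm_absVal_sub_mean_sq_le A p hp_nonneg hp_sum x a hx
  have hVy := sum_mul_norm_absVal_sub_mean_sq_le A p hp_nonneg hp_sum y b hy
  have hVx0 : 0 ≤ ∑ i, p i * ‖absVal A (x i - ∑ j, (p j : ℂ) • x j)‖ ^ 2 :=
    Finset.sum_nonneg fun i _ => mul_nonneg (hp_nonneg i) (sq_nonneg _)
  have hVy0 : 0 ≤ ∑ i, p i * ‖absVal A (y i - ∑ j, (p j : ℂ) • y j)‖ ^ 2 :=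
    Finset.sum_nonneg fun i _ => mul_nonneg (hp_nonneg i) (sq_nonneg _)
  have hCS := Finset.sum_sq_le_sum_mul_sum_of_sq_le_mul Finset.univ
    (r := fun i => p i * (‖absVal A (x i - ∑ j, (p j : ℂ) • x j)‖ *
      ‖absVal A (y i - ∑ j, (p j : ℂ) • y j)‖))
    (fun i _ => mul_nonneg (hp_nonneg i) (sq_nonneg ‖absVal A (x i - ∑ j, (p j : ℂ) • x j)‖))
    (fun i _ => mul_nonneg (hp_nonneg i) (sq_nonneg ‖absVal A (y i - ∑ j, (p j : ℂ) • y j)‖))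
    (fun i _ => le_of_eq (by ring))
  set α := ‖absVal A (∑ i, (p i : ℂ) • (x i - a))‖
  set β := ‖absVal A (∑ i, (p i : ℂ) • (y i - b))‖
  have hα : α ≤ r := le_of_sq_le_sq (by linarith) hr
  have hβ : β ≤ s := le_of_sq_le_sq (by linarith) hs
  have hαβ : α * β ≤ r * s := mul_le_mul hα hβ (norm_nonneg _) hr
  refine le_of_sq_le_sq ?_ (sub_nonneg.2 hαβ)
  calc _ ≤ _ := hCS
    _ ≤ (r ^ 2 - α ^ 2) * (s ^ 2 - β ^ 2) := mul_le_mul hVx hVy hVy0 (hVx0.trans hVx)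
    -- Aczél's inequality; the difference of the two sides is `(r β - s α)²`
    _ ≤ (r * s - α * β) ^ 2 := by linarith [sq_nonneg (r * β - s * α)]
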